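/- Let $A=\{0,1\}$. Partial functions $f:A^*\to A^*$ form a monoid under composition. A *machine* is a deterministic Turing machine with a read-only input tape (content $\#\,z\,\mathsf B$ on input $z\in A^*$, the head starting on $\#$), a write-only output tape, and finitely many work tapes (initially blank) over an arbitrary finite alphabet. The heads on the input and output tapes never move left. There is a special halting output state $q_{\rm out}$. If the machine $M$ reaches $q_{\rm out}$ on input $z$, then $f_M(z)$ is the content of the output tape at that moment; otherwise $f_M(z)$ is undefined. A *right-ideal morphism* is a partial function $f$ such that for all $x\in{\rm Dom}(f)$ and $w\in A^*$: $xw\in{\rm Dom}(f)$ and $f(xw)=f(x)\,w$. The set ${\cal RM}_2^{\sf P}$ consists of the right-ideal morphisms $f$ that are computed by some machine which halts on every input $x$ after at most polynomially (in $|x|$) many steps, and that are polynomially balanced (there are polynomials $p,p'$ with $|f(x)|\le p(|x|)$ and $|x|\le p'(|f(x)|)$ for all $x\in{\rm Dom}(f)$). An *${\cal RM}_2^{\sf P}$-program* with built-in polynomial $p(n)=a'n^{k'}+a'$ (with integers $a',k'\ge 1$) is a machine $M$ such that: 1. for all $x\in{\rm Dom}(f_M)$ and $z\in A^*$, in the computation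 of $M$ on input $xz$, no transition is made with the input head on $z\,\mathsf B$ before $f_M(x)$ has been written on the output tape; 2. for all $x\in{\rm Dom}(f_M)$ and $z\in A^*$, in the computation of $M$ on input $xz$, after $f_M(x)$ the remaining input $z$ is copied to the output tape, and at that point, on reading $\mathsf B$, the state $q_{\rm out}$ is reached with output $f_M(x)\,z$; 3. on every input $x$, $M$ halts after at most $p(|x|)$ steps; 4. $|x|\le p(|f_M(x)|)$ for all $x\in{\rm Dom}(f_M)$. For a function $q:\mathbb N\to\mathbb N$ let ${\cal S}_2^{(q)}$ be the set of all $f\in{\cal RM}_2^{\sf P}$ that are computed by an ${\cal RM}_2^{\sf P}$-program whose built-in polynomial $p$ satisfies $p(n)\le q(n)$ for all $n\ge 0$, and let ${\cal RM}_2^{(q)}=\langle{\cal S}_2^{(q)}\rangle$ be the monoid generated by ${\cal S}_2^{(q)}$ under composition. **Theorem.** There is a constant $a_0>1$ such that for every polynomial $q(n)=a\,n^k+a$ with integers $k\ge 5$ and $a>a_0$, the monoid ${\cal RM}_2^{(q)}$ is not finitely generated. -/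

import Mathlib

/-! ### Partial functions on binary words -/

/-- Partial functions from words over the alphabet `{0,1}` to words over `{0,1}`. -/
def WordFun : Type := List Bool →. List Bool

namespace WordFun

/-- `f.Maps x y`: the partial function `f` is defined at `x`, and `f(x) = y`. -/
def Maps (f : WordFun) (x y : List Bool) : Prop := y ∈ (show List Bool →. List Bool from f) x

/-- The monoid of all partial functions on words, under composition: `(f * g)(x) = f(g(x))`. -/
instance : Monoid WordFun where
  one := PFun.id (List Bool)
  mul f g := PFun.comp f g
  mul_assoc f g h := PFun.comp_assoc f g h
  one_mul f := PFun.id_comp f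
  mul_one f := PFun.comp_id f

theorem ext_maps {f g : WordFun} (h : ∀ x y, f.Maps x y ↔ g.Maps x y) : f = g :=
  PFun.ext h

theorem maps_one (x y : List Bool) : (1 : WordFun).Maps x y ↔ y = x :=
  Part.mem_some_iff

theorem maps_mul (f g : WordFun) (x y : List Bool) :
    (f * g).Maps x y ↔ ∃ u, g.Maps x u ∧ f.Maps u y :=
  Part.mem_bind_iff

/-- Right-ideal morphisms: if `h` is defined at `x` then `h(xw) = h(x)w` for every word `w`
(in particular the domain is a right ideal). -/
def IsRightIdealMorphism (h : WordFun) : Prop :=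
  ∀ x y, h.Maps x y → ∀ w, h.Maps (x ++ w) (y ++ w)

/-- Polynomial balance: output length is polynomially bounded in input length and conversely. -/
def PolyBalanced (f : WordFun) : Prop :=
  ∃ p q : Polynomial ℕ, ∀ x y, f.Maps x y →
    y.length ≤ p.eval x.length ∧ x.length ≤ q.eval y.length

end WordFun

/-! ### Input-output Turing machines -/

/-- Letters on the input tape: the left endmarker `#`, the letters `0`, `1`, and the right
endmarker (blank) `B`. -/
inductive InSym : Type
  | lmark
  | letter (b : Bool)
  | blank

/-- The letter at position `i` of the input tape with content `# z B` (blank after that). -/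
def inputSym (z : List Bool) : ℕ → InSym
  | 0 => InSym.lmark
  | i + 1 => (z[i]?).elim InSym.blank InSym.letter

/-- What one transition does. On the input tape the head moves right (`advance = true`) or stays.
On the output tape a letter is appended, or nothing is done. On each work tape a letter is
written, and then the head moves left, right, or (`none`) stays. -/
structure MachineAction (Q Γ : Type) (tapes : ℕ) where
  state : Q
  advance : Bool
  emit : Option Bool
  write : Fin tapes → Γ
  move : Fin tapes → Option Turing.Dir

/-- Deterministic multi-tape Turing machines with a read-only one-way input tape, a write-only
one-way output tape, and any finite number of two-way work tapes, whose blank is `default : Γ`.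
`δ q s g = none` means that there is no transition; there is none from the output state. -/
structure IOMachine where
  Q : Type
  Γ : Type
  [finiteQ : Finite Q]
  [finiteΓ : Finite Γ]
  [inhabitedΓ : Inhabited Γ]
  tapes : ℕ
  start : Q
  out : Q
  δ : Q → InSym → (Fin tapes → Γ) → Option (MachineAction Q Γ tapes)
  δ_out : ∀ s g, δ out s g = none

namespace IOMachine

attribute [instance] IOMachine.finiteQ IOMachine.finiteΓ IOMachine.inhabitedΓ

/-- Configurations. `pos` is the position of the input head (`0` is the endmarker `#`), and
`output` is the word that has been written on the output tape. -/
structure Cfg (M : IOMachine) where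
  state : M.Q
  pos : ℕ
  work : Fin M.tapes → Turing.Tape M.Γ
  output : List Bool

variable (M : IOMachine)

/-- The initial configuration: input head on `#`, blank work tapes, no output. -/
def init : M.Cfg where
  state := M.start
  pos := 0
  work := fun _ => Turing.Tape.mk₁ []
  output := []

/-- One transition on the input `z`; `none` if the machine has halted. -/
def step (z : List Bool) (c : M.Cfg) : Option M.Cfg :=
  (M.δ c.state (inputSym z c.pos) fun i => (c.work i).head).map fun A =>
    { state := A.state
      pos := if A.advance then c.pos + 1 else c.pos
      work := fun i =>
        let T := (c.work i).write (A.write i)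
        (A.move i).elim T fun d => T.move d
      output := c.output ++ A.emit.toList }

/-- The configuration after exactly `t` transitions on the input `z` (`none` if the machine has
halted before). -/
def run (z : List Bool) : ℕ → Option M.Cfg
  | 0 => some M.init
  | t + 1 => (run z t).bind (M.step z)

/-- On the input `z`, the machine halts after at most `T` transitions. -/
def HaltsWithin (z : List Bool) (T : ℕ) : Prop :=
  ∃ t ≤ T, ∃ c, M.run z t = some c ∧ M.step z c = none

/-- The input-output function `f_M` of the machine, as a relation: on the input `z` the output
state is reached, and then the content of the output tape is `y`. If the machine halts in another
state or does not halt then there is no output. -/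
def Outputs (z y : List Bool) : Prop :=
  ∃ t c, M.run z t = some c ∧ c.state = M.out ∧ c.output = y

/-- The machine computes the partial function `f`. -/
def Computes (f : WordFun) : Prop :=
  ∀ x y, f.Maps x y ↔ M.Outputs x y

/-- Sequential machines: if `f_M(x) = y` then, on any input `xz`, no transition is made with the
input head on the part `z B` of the input tape before `y` has been written on the output tape. -/
def IsSequential : Prop :=
  ∀ x y, M.Outputs x y → ∀ z t c, M.run (x ++ z) t = some c → x.length < c.pos →
    (M.step (x ++ z) c).isSome → y <+: c.output

/-- If `f_M(x) = y` then, on any input `xz`, the remaining input `z` is copied to the output tape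
after `y`, and at that point the output state is reached, that is, the transition that reads
the right endmarker leads to the output state. -/
def CopiesRest : Prop :=
  ∀ x y, M.Outputs x y → ∀ z, M.Outputs (x ++ z) (y ++ z) ∧
    ∀ t c c', M.run (x ++ z) t = some c → (x ++ z).length < c.pos →
      M.step (x ++ z) c = some c' → c'.state = M.out

end IOMachine

/-! ### The monoids -/

/-- `fP`: the polynomially balanced partial functions that are computed by a deterministic
polynomial-time Turing machine. -/
def fP : Set WordFun :=
  {f | f.PolyBalanced ∧ ∃ (M : IOMachine) (p : Polynomial ℕ),
    M.Computes f ∧ ∀ x, M.HaltsWithin x (p.eval x.length)}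

/-- `RM_2^P`: the right-ideal morphisms in `fP`. -/
def RM2P : Set WordFun :=
  {f | f ∈ fP ∧ f.IsRightIdealMorphism}

/-- The polynomial `a n^k + a`. -/
def builtinPoly (a k n : ℕ) : ℕ := a * n ^ k + a

/-- `RM_2^P`-programs: sequential machines that copy the rest of the input, with a built-in
polynomial `p(n) = a n^k + a` that bounds the running time on every input, and the input
balance. -/
structure RMProgram where
  machine : IOMachine
  a : ℕ
  k : ℕ
  a_pos : 1 ≤ a
  k_pos : 1 ≤ k
  sequential : machine.IsSequential
  copiesRest : machine.CopiesRest
  time_le : ∀ x, machine.HaltsWithin x (builtinPoly a k x.length)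
  balance_le : ∀ x y, machine.Outputs x y → x.length ≤ builtinPoly a k y.length

/-- `S_2^(q)`: the functions in `RM_2^P` that are computed by an `RM_2^P`-program whose built-in
polynomial is at most `q` everywhere. -/
def S2 (q : ℕ → ℕ) : Set WordFun :=
  {f | f ∈ RM2P ∧ ∃ w : RMProgram, (∀ n, builtinPoly w.a w.k n ≤ q n) ∧ w.machine.Computes f}

/-- `RM_2^(q)`: the submonoid generated by `S_2^(q)`. -/
def RM2 (q : ℕ → ℕ) : Submonoid WordFun := Submonoid.closure (S2 q)

/-!
The monoid `RM_2^(q)` is not finitely generated because, for any finitely many functions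
`g 0, …, g m` in `S_2^(q)`, diagonalization over their products yields a further function in
`S_2^(q)`. Products of unbounded length take times of unbounded polynomial degree, so they cannot
simply be simulated; what helps is that right-ideal morphisms make it possible to wait.

The new function `f` is a partial identity. Its input is thought of as a sequence of stages. In
stage `j` an index `i_j` is read, then a long block of letters `0`, and then `g (i_j)` is applied to
the current value, which is the result of the previous stages continued by the letters read since
then. If `g (i_j)` is undefined there, then `f` becomes defined at this point; otherwise the result
is the new current value. Since the `g i` are right-ideal morphisms, the current value is the value
of `g (i_j) ⋯ g (i_1)` on the input read so far. Hence for each word `w = i_1 … i_r` there is an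
input on which exactly one of `f` and `g (i_r) ⋯ g (i_1)` is defined (`diag_ne_prod`). The block of
letters `0` is as long as the computation in the previous stage, so that the previous stages account
for a linear part of the time only, and the last one applies a single `g i` to a word of linear
length (`diag_reads`). So `f` takes time `O(n ^ k)`.

The constant in this bound is larger than that of `q`, and it has to be brought down by linear
speedup. For this purpose `f` is computed by an `OnlineStackMachine`, whose stacks are cut into
blocks of constant length, and `accelerate` is a sequential Turing machine that treats a block as a
single letter (`Represents.three_steps`). It copies the input while reading it, so it satisfies the
conditions on `RM_2^P`-programs (`partialId_mem_S2`).
-/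

/-! ### Runs of input-output machines -/

namespace IOMachine

variable (M : IOMachine)

/-- The configuration reached from `c` after exactly `s` transitions on the input `z`. -/
def iter (z : List Bool) : ℕ → M.Cfg → Option M.Cfg
  | 0, c => some c
  | s + 1, c => (M.step z c).bind (iter z s)

theorem iter_add {z : List Bool} {s : ℕ} {c d : M.Cfg} (h : M.iter z s c = some d) (t : ℕ) :
    M.iter z (s + t) c = M.iter z t d := by
  induction s generalizing c with
  | zero => simp only [iter, Option.some.injEq] at h; simp [h]
  | succ s ih =>
    rw [Nat.succ_add]
    simp only [iter] at h ⊢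
    cases hc : M.step z c with
    | none => simp [hc] at h
    | some e => rw [hc] at h; exact ih h

theorem run_add_iter {z : List Bool} {t : ℕ} {c : M.Cfg} (h : M.run z t = some c) (s : ℕ) :
    M.run z (t + s) = M.iter z s c := by
  induction s generalizing t c with
  | zero => simpa [iter] using h
  | succ s ih =>
    rw [show t + (s + 1) = (t + 1) + s by omega]
    simp only [iter]
    have h1 : M.run z (t + 1) = M.step z c := by simp [run, h]
    cases hc : M.step z c with
    | none =>
      rw [hc] at h1
      have : ∀ s, M.run z (t + 1 + s) = none := by
        intro s
        induction s with
        | zero => exact h1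
        | succ s ih => rw [← add_assoc, run, ih]; rfl
      simp [this]
    | some d => rw [hc] at h1; exact ih h1

theorem step_out {z : List Bool} {c : M.Cfg} (h : c.state = M.out) : M.step z c = none := by
  simp [step, h, M.δ_out]

/-- A run can halt in only one configuration. -/
theorem halt_unique {z : List Bool} {t t' : ℕ} {c c' : M.Cfg} (h : M.run z t = some c)
    (hc : M.step z c = none) (h' : M.run z t' = some c') (hc' : M.step z c' = none) :
    t = t' ∧ c = c' := by
  have key : ∀ {t t' : ℕ} {c c' : M.Cfg}, M.run z t = some c → M.step z c = none →
      M.run z t' = some c' → t' ≤ t := by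
    intro t t' c c' h hc h'
    by_contra hlt
    obtain ⟨s, rfl⟩ : ∃ s, t' = t + (s + 1) := ⟨t' - t - 1, by omega⟩
    rw [M.run_add_iter h, iter, hc] at h'
    simp at h'
  have e : t = t' := le_antisymm (key h' hc' h) (key h hc h')
  subst e
  exact ⟨rfl, Option.some.inj (h.symm.trans h')⟩

theorem outputs_iff_of_halt {z : List Bool} {t : ℕ} {c : M.Cfg} (h : M.run z t = some c)
    (hc : M.step z c = none) (y : List Bool) :
    M.Outputs z y ↔ c.state = M.out ∧ c.output = y := by
  constructor
  · rintro ⟨t', c', h', hs, ho⟩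
    obtain ⟨-, rfl⟩ := M.halt_unique h hc h' (M.step_out hs)
    exact ⟨hs, ho⟩
  · rintro ⟨hs, ho⟩
    exact ⟨t, c, h, hs, ho⟩

end IOMachine

theorem inputSym_of_length_lt {z : List Bool} {p : ℕ} (h : z.length < p) :
    inputSym z p = InSym.blank := by
  obtain ⟨i, rfl⟩ : ∃ i, p = i + 1 := ⟨p - 1, by omega⟩
  have : z[i]? = none := by simp; omega
  simp [inputSym, this]

theorem inputSym_append_cons (x : List Bool) (b : Bool) (z : List Bool) :
    inputSym (x ++ b :: z) (x.length + 1) = InSym.letter b := by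
  simp [inputSym]

/-! ### Online stack machines -/

/-- The instructions for a single stack. Popping the empty stack does nothing. -/
inductive StackOp (Γ : Type) : Type
  | keep
  | pop
  | push (g : Γ)

/-- The effect of an instruction on a stack, whose top is the head of the list. -/
def StackOp.apply {Γ : Type} : StackOp Γ → List Γ → List Γ
  | keep, l => l
  | pop, l => l.tail
  | push g, l => g :: l

/-- Deterministic machines with finitely many stacks that process a word letter by letter. Each
step depends on the state, the current letter, and the tops of the stacks, and yields the next
state, a flag which tells whether the machine has finished the current letter, and an instruction
for each stack. The accepting state `acc` is never left. -/
structure OnlineStackMachine where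
  Q : Type
  Γ : Type
  ι : Type
  [finiteQ : Finite Q]
  [finiteΓ : Finite Γ]
  [finiteι : Finite ι]
  start : Q
  acc : Q
  δ : Q → Bool → (ι → Option Γ) → (Q × Bool) × (ι → StackOp Γ)
  δ_acc : ∀ b g, δ acc b g = ((acc, true), fun _ => StackOp.keep)

namespace OnlineStackMachine

attribute [instance] finiteQ finiteΓ finiteι

/-- Configurations: the state and the contents of the stacks. -/
@[ext] structure Cfg (H : OnlineStackMachine) where
  state : H.Q
  stack : H.ι → List H.Γ

variable (H : OnlineStackMachine)

/-- The initial configuration, with empty stacks. -/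
def init : H.Cfg := ⟨H.start, fun _ => []⟩

/-- One step on the letter `b`, together with the flag which tells whether the letter is
finished. -/
def step (b : Bool) (c : H.Cfg) : H.Cfg × Bool :=
  let r := H.δ c.state b fun i => (c.stack i).head?
  (⟨r.1.1, fun i => (r.2 i).apply (c.stack i)⟩, r.1.2)

/-- `H.Steps b c t c'`: from `c`, after `t` steps on the letter `b`, none of which finishes the
letter, the configuration is `c'`. -/
inductive Steps (b : Bool) : H.Cfg → ℕ → H.Cfg → Prop
  | refl (c) : Steps b c 0 c
  | head {c c₁ t c'} : H.step b c = (c₁, false) → Steps b c₁ t c' → Steps b c (t + 1) c'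

/-- `H.Processes b c t c'`: from `c`, the `t`-th step on the letter `b` is the one that finishes
the letter, and leads to `c'`. -/
inductive Processes (b : Bool) : H.Cfg → ℕ → H.Cfg → Prop
  | finish {c c'} : H.step b c = (c', true) → Processes b c 1 c'
  | head {c c₁ t c'} : H.step b c = (c₁, false) → Processes b c₁ t c' → Processes b c (t + 1) c'

/-- `H.Reads c x t c'`: from `c`, processing the word `x` takes `t` steps and leads to `c'`. -/
inductive Reads : H.Cfg → List Bool → ℕ → H.Cfg → Prop
  | nil (c) : Reads c [] 0 c
  | cons {c b t c₁ x s c'} : H.Processes b c t c₁ → Reads c₁ x s c' → Reads c (b :: x) (t + s) c'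

/-- The words whose processing leads to the accepting state. -/
def Accepts (x : List Bool) : Prop :=
  ∃ t c, H.Reads H.init x t c ∧ c.state = H.acc

variable {H}

theorem Steps.trans {b : Bool} {c c₁ c₂ : H.Cfg} {s t : ℕ} (h : H.Steps b c s c₁)
    (h' : H.Steps b c₁ t c₂) : H.Steps b c (s + t) c₂ := by
  induction h with
  | refl => simpa using h'
  | head e _ ih => rw [Nat.succ_add]; exact .head e (ih h')

theorem Steps.processes {b : Bool} {c c₁ c₂ : H.Cfg} {s t : ℕ} (h : H.Steps b c s c₁)
    (h' : H.Processes b c₁ t c₂) : H.Processes b c (s + t) c₂ := by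
  induction h with
  | refl => simpa using h'
  | head e _ ih => rw [Nat.succ_add]; exact .head e (ih h')

theorem Reads.append {c c₁ c₂ : H.Cfg} {x y : List Bool} {s t : ℕ} (h : H.Reads c x s c₁)
    (h' : H.Reads c₁ y t c₂) : H.Reads c (x ++ y) (s + t) c₂ := by
  induction h with
  | nil => simpa using h'
  | cons e _ ih => rw [List.cons_append, add_assoc]; exact .cons e (ih h')

theorem Processes.reads {c c' : H.Cfg} {b : Bool} {t : ℕ} (h : H.Processes b c t c') :
    H.Reads c [b] t c' := by
  simpa using Reads.cons h (.nil _)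

theorem Processes.unique {c c₁ c₂ : H.Cfg} {b : Bool} {s t : ℕ} (h : H.Processes b c s c₁)
    (h' : H.Processes b c t c₂) : s = t ∧ c₁ = c₂ := by
  induction h generalizing t with
  | finish e =>
    cases h' with
    | finish e' => rw [e] at e'; simpa using e'
    | head e' _ => rw [e] at e'; simp at e'
  | head e _ ih =>
    cases h' with
    | finish e' => rw [e] at e'; simp at e'
    | head e' h' =>
      rw [e] at e'
      obtain rfl : _ = _ := (Prod.mk.inj e').1
      simpa using ih h'

theorem Reads.unique {c c₁ c₂ : H.Cfg} {x : List Bool} {s t : ℕ} (h : H.Reads c x s c₁)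
    (h' : H.Reads c x t c₂) : s = t ∧ c₁ = c₂ := by
  induction h generalizing t with
  | nil => cases h'; exact ⟨rfl, rfl⟩
  | cons e _ ih =>
    cases h' with
    | cons e' h' =>
      obtain ⟨rfl, rfl⟩ := e.unique e'
      obtain ⟨rfl, rfl⟩ := ih h'
      exact ⟨rfl, rfl⟩

theorem step_of_acc {c : H.Cfg} (hc : c.state = H.acc) (b : Bool) : H.step b c = (c, true) := by
  cases c with
  | mk q s =>
    simp only at hc
    subst hc
    simp [step, H.δ_acc, StackOp.apply]

theorem reads_of_acc {c : H.Cfg} (hc : c.state = H.acc) (x : List Bool) :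
    H.Reads c x x.length c := by
  induction x with
  | nil => exact .nil c
  | cons b x ih =>
    rw [List.length_cons, add_comm]
    exact .cons (.finish (step_of_acc hc b)) ih

theorem Accepts.append {x : List Bool} (h : H.Accepts x) (z : List Bool) :
    H.Accepts (x ++ z) := by
  obtain ⟨t, c, hr, hc⟩ := h
  exact ⟨_, c, hr.append (reads_of_acc hc z), hc⟩

theorem accepts_iff {x : List Bool} {t : ℕ} {c : H.Cfg} (h : H.Reads H.init x t c) :
    H.Accepts x ↔ c.state = H.acc := by
  constructor
  · rintro ⟨t', c', h', hc⟩
    rwa [(h.unique h').2]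
  · exact fun hc => ⟨t, c, h, hc⟩

variable (H)

/-- At most `n` steps on the letter `b`, as a function; the flag tells whether the letter has been
finished, in which case no further step is made. -/
def steps (b : Bool) : ℕ → H.Cfg → H.Cfg × Bool
  | 0, c => (c, false)
  | n + 1, c => if (H.step b c).2 then H.step b c else steps b n (H.step b c).1

variable {H}

theorem Processes.steps_of_le {c c' : H.Cfg} {b : Bool} {t n : ℕ} (h : H.Processes b c t c')
    (hn : t ≤ n) : H.steps b n c = (c', true) := by
  induction h generalizing n with
  | finish e =>
    obtain ⟨n, rfl⟩ : ∃ k, n = k + 1 := ⟨n - 1, by omega⟩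
    simp [steps, e]
  | head e _ ih =>
    obtain ⟨n, rfl⟩ : ∃ k, n = k + 1 := ⟨n - 1, by omega⟩
    simp [steps, e, ih (by omega : _ ≤ n)]

theorem Processes.steps_of_lt {c c' : H.Cfg} {b : Bool} {t n : ℕ} (h : H.Processes b c t c')
    (hn : n < t) : ∃ c₁, H.steps b n c = (c₁, false) ∧ H.Processes b c₁ (t - n) c' := by
  induction n generalizing c t with
  | zero => exact ⟨c, rfl, h⟩
  | succ n ih =>
    cases h with
    | finish e => omega
    | head e h =>
      obtain ⟨c₁, h1, h2⟩ := ih h (by omega)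
      exact ⟨c₁, by simp [steps, e, h1], by simpa using h2⟩

/-- The configuration obtained by putting the stack contents of `c` on top of `r`. -/
def Cfg.onTop (c : H.Cfg) (r : H.ι → List H.Γ) : H.Cfg := ⟨c.state, fun i => c.stack i ++ r i⟩

theorem step_onTop (b : Bool) (c : H.Cfg) (r : H.ι → List H.Γ)
    (h : ∀ i, c.stack i ≠ [] ∨ r i = []) :
    H.step b (c.onTop r) = ((H.step b c).1.onTop r, (H.step b c).2) := by
  have e : (fun i => (c.stack i ++ r i).head?) = fun i => (c.stack i).head? := by
    funext i
    rcases h i with h | h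
    · rw [List.head?_append_of_ne_nil _ h]
    · simp [h]
  simp only [step, Cfg.onTop, e, Prod.mk.injEq, and_true, Cfg.mk.injEq, true_and]
  funext i
  cases ((H.δ c.state b fun i => (c.stack i).head?).2 i) with
  | keep => rfl
  | push g => rfl
  | pop =>
    rcases h i with h | h
    · simp [StackOp.apply, List.tail_append_of_ne_nil h]
    · simp [StackOp.apply, h]

theorem length_step_le (b : Bool) (c : H.Cfg) (i : H.ι) :
    ((H.step b c).1.stack i).length ≤ (c.stack i).length + 1 ∧
      (c.stack i).length ≤ ((H.step b c).1.stack i).length + 1 := by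
  simp only [step]
  cases ((H.δ c.state b fun i => (c.stack i).head?).2 i) <;> simp [StackOp.apply] <;> omega

theorem length_steps_le (b : Bool) (n : ℕ) (c : H.Cfg) (i : H.ι) :
    ((H.steps b n c).1.stack i).length ≤ (c.stack i).length + n := by
  induction n generalizing c with
  | zero => simp [steps]
  | succ n ih =>
    have h1 := (length_step_le b c i).1
    rw [steps]
    split_ifs
    · omega
    · have := ih (H.step b c).1
      omega

/-- `n` steps see only the upper `n` symbols of each stack. -/
theorem steps_onTop (b : Bool) (n : ℕ) (c : H.Cfg) (r : H.ι → List H.Γ)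
    (h : ∀ i, n ≤ (c.stack i).length ∨ r i = []) :
    H.steps b n (c.onTop r) = ((H.steps b n c).1.onTop r, (H.steps b n c).2) := by
  induction n generalizing c with
  | zero => rfl
  | succ n ih =>
    have h0 : ∀ i, c.stack i ≠ [] ∨ r i = [] := fun i =>
      (h i).imp_left fun hi he => by simp [he] at hi
    have h1 : ∀ i, n ≤ ((H.step b c).1.stack i).length ∨ r i = [] := fun i =>
      (h i).imp_left fun hi => by have := (length_step_le b c i).2; omega
    rw [steps, steps, step_onTop b c r h0]
    dsimp only
    split_ifs with hf
    · rfl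
    · exact ih _ h1

end OnlineStackMachine

/-! ### Stacks on Turing machine tapes -/

/-- The tape that holds the stack `l`, with the head on the top, which is the rightmost nonblank
cell (or with the head on any cell of the blank tape, for the empty stack). -/
def stackTape {β : Type} (l : List β) : Turing.Tape (Option β) :=
  ⟨l.head?, Turing.ListBlank.mk (l.tail.map some), Turing.ListBlank.mk []⟩

theorem listBlank_mk_default {Γ : Type} [Inhabited Γ] :
    Turing.ListBlank.mk [(default : Γ)] = Turing.ListBlank.mk [] := by
  simpa using Turing.ListBlank.cons_head_tail (Turing.ListBlank.mk ([] : List Γ))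

theorem stackTape_pop {β : Type} (l : List β) :
    ((stackTape l).write none).move Turing.Dir.left = stackTape l.tail := by
  have h := listBlank_mk_default (Γ := Option β)
  cases l with
  | nil => simp [stackTape, Turing.Tape.write, Turing.Tape.move]; exact ⟨rfl, h⟩
  | cons a l =>
    cases l with
    | nil => simp [stackTape, Turing.Tape.write, Turing.Tape.move]; exact ⟨rfl, h⟩
    | cons b l => simp [stackTape, Turing.Tape.write, Turing.Tape.move]; exact h

theorem stackTape_push {β : Type} (l : List β) (a : β) :
    ((stackTape l).move Turing.Dir.right).write (some a) = stackTape (a :: l) := by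
  have h := listBlank_mk_default (Γ := Option β)
  cases l with
  | nil => simp [stackTape, Turing.Tape.write, Turing.Tape.move]; exact h
  | cons b l => simp [stackTape, Turing.Tape.write, Turing.Tape.move]

/-! ### Sequential machines for accelerated online stack machines -/

namespace OnlineStackMachine

variable (H : OnlineStackMachine) (C : ℕ)

/-- Stack pieces of length at most `3 * C`. -/
abbrev Buffer : Type := {l : List H.Γ // l.length ≤ 3 * C}

/-- Configurations of `H` with bounded stacks. -/
abbrev BoundedCfg : Type := H.Q × (H.ι → H.Buffer C)

variable {H C}

/-- A bounded configuration, as a configuration. -/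
def BoundedCfg.toCfg (c : H.BoundedCfg C) : H.Cfg := ⟨c.1, fun i => (c.2 i).1⟩

variable (H)

/-- The list `l` as a buffer; its part below depth `3 * C` is discarded. -/
def clipList (C : ℕ) (l : List H.Γ) : H.Buffer C := ⟨l.take (3 * C), by simp⟩

/-- The configuration `c` as a bounded configuration; everything below depth `3 * C` is
discarded. -/
def clip (C : ℕ) (c : H.Cfg) : H.BoundedCfg C := (c.state, fun i => H.clipList C (c.stack i))

variable {H}

theorem clipList_val {l : List H.Γ} (h : l.length ≤ 3 * C) : (H.clipList C l).1 = l :=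
  List.take_of_length_le h

theorem toCfg_clip {c : H.Cfg} (h : ∀ i, (c.stack i).length ≤ 3 * C) :
    (H.clip C c).toCfg = c := by
  cases c with
  | mk q s =>
    simp only [clip, BoundedCfg.toCfg, Cfg.mk.injEq, true_and]
    funext i
    exact clipList_val (h i)

/-- The phases of the machine `accelerate`. -/
inductive Phase : Type
  | begin
  | simulate
  | fetch
  | store
  | out

instance : Finite Phase :=
  Finite.of_injective (β := Fin 5) (fun p => match p with
    | .begin => 0 | .simulate => 1 | .fetch => 2 | .store => 3 | .out => 4)
    (by intro p q; cases p <;> cases q <;> simp)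

variable (H C)

instance : Finite (H.Buffer C) := (List.finite_length_le H.Γ (3 * C)).to_subtype

/-- The stack indices, as tape indices. -/
noncomputable def tapeEquiv : H.ι ≃ Fin (Nat.card H.ι) := Finite.equivFin H.ι

variable {H C}

/-- The buffer `l` after the phase `fetch`, in which the block `h` has been read from the tape. -/
def fetchBuffer (l : H.Buffer C) (h : Option (H.Buffer C)) : H.Buffer C :=
  if l.1.length < C then H.clipList C (l.1 ++ h.elim [] Subtype.val) else l

/-- What the phase `fetch` writes on the tape cell that contains `h`. -/
def fetchWrite (l : H.Buffer C) (h : Option (H.Buffer C)) : Option (H.Buffer C) :=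
  if l.1.length < C then none else h

/-- The move on the tape in the phase `fetch`. If a block will be stored in the next phase, the
head already goes to the cell above the top. -/
def fetchMove (l : H.Buffer C) : Option Turing.Dir :=
  if l.1.length < C then some .left else if 2 * C ≤ l.1.length then some .right else none

/-- The buffer `l` after the phase `store`. -/
def storeBuffer (l : H.Buffer C) : H.Buffer C :=
  if 2 * C ≤ l.1.length then H.clipList C (l.1.take (l.1.length - C)) else l

/-- What the phase `store` writes on the tape cell that contains `h`. -/
def storeWrite (l : H.Buffer C) (h : Option (H.Buffer C)) : Option (H.Buffer C) :=
  if 2 * C ≤ l.1.length then some (H.clipList C (l.1.drop (l.1.length - C))) else h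

variable (H C)

/-- The sequential machine that simulates `C` steps of `H` by three transitions, and copies the
input word as it is read. The upper parts of the stacks of `H`, with lengths between `C` and
`2 * C` (or less, if nothing is below), are kept in the control state; the rests are kept on the
tapes, in blocks of length `C`.
The three transitions simulate up to `C` steps in the control state, fetch a block from each tape
whose buffer has become shorter than `C`, and store a block on each tape whose buffer has become
too long. The flag in the state tells whether `H` has finished the current letter; then the machine
copies the letter and goes on to the next one. On the right endmarker the output state is reached
from the accepting state of `H` only. -/
noncomputable def accelerate : IOMachine where
  Q := Phase × Bool × H.BoundedCfg C
  Γ := Option (H.Buffer C)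
  tapes := Nat.card H.ι
  start := (.begin, false, H.clip C H.init)
  out := (.out, false, H.clip C H.init)
  δ q s g :=
    match q, s with
    | (.begin, _, c), .lmark => some
        { state := (.simulate, false, c), advance := true, emit := none
          write := g, move := fun _ => none }
    | (.simulate, _, c), .letter b => some
        { state := (.fetch, (H.steps b C c.toCfg).2, H.clip C (H.steps b C c.toCfg).1)
          advance := false, emit := none, write := g, move := fun _ => none }
    | (.fetch, f, c), .letter _ => some
        { state := (.store, f, c.1, fun i => fetchBuffer (c.2 i) (g (H.tapeEquiv i)))
          advance := false, emit := none
          write := fun j => fetchWrite (c.2 (H.tapeEquiv.symm j)) (g j)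
          move := fun j => fetchMove (c.2 (H.tapeEquiv.symm j)) }
    | (.store, f, c), .letter b => some
        { state := (.simulate, false, c.1, fun i => storeBuffer (c.2 i))
          advance := f, emit := if f then some b else none
          write := fun j => storeWrite (c.2 (H.tapeEquiv.symm j)) (g j)
          move := fun _ => none }
    | (.simulate, _, c), .blank =>
        open Classical in
        if c.1 = H.acc then some
          { state := (.out, false, H.clip C H.init), advance := false, emit := none
            write := g, move := fun _ => none }
        else none
    | _, _ => none
  δ_out _ _ := rfl

/-- Each transition copies the letter that the input head leaves, if any. -/
theorem accelerate_emit {q : (H.accelerate C).Q} {s : InSym} {g} {A}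
    (h : (H.accelerate C).δ q s g = some A) :
    (A.advance = false ∧ A.emit = none) ∨ (A.advance = true ∧ s = .lmark ∧ A.emit = none) ∨
      (A.advance = true ∧ ∃ b, s = .letter b ∧ A.emit = some b) := by
  obtain ⟨ph, f, c⟩ := q
  cases ph <;> cases s <;> simp only [accelerate, reduceCtorEq] at h
  case simulate.blank =>
    split_ifs at h
    obtain rfl := Option.some.inj h
    simp
  all_goals obtain rfl := Option.some.inj h
  case store.letter => cases f <;> simp
  all_goals simp

theorem accelerate_blank {q : (H.accelerate C).Q} {g} {A}
    (h : (H.accelerate C).δ q .blank g = some A) : A.state = (H.accelerate C).out := by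
  obtain ⟨ph, f, c⟩ := q
  cases ph <;> simp only [accelerate, reduceCtorEq] at h
  split_ifs at h
  obtain rfl := Option.some.inj h
  rfl

/-- At any time, the output is the part of the input word that the input head has passed. -/
theorem accelerate_output {z : List Bool} {t : ℕ} {c : (H.accelerate C).Cfg}
    (h : (H.accelerate C).run z t = some c) :
    c.output = z.take (c.pos - 1) := by
  induction t generalizing c with
  | zero =>
    simp only [IOMachine.run, Option.some.injEq] at h
    subst h
    simp [IOMachine.init]
  | succ t ih =>
    simp only [IOMachine.run, Option.bind_eq_some_iff] at h
    obtain ⟨d, hd, h⟩ := h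
    have hd := ih hd
    simp only [IOMachine.step, Option.map_eq_some_iff] at h
    obtain ⟨A, hA, rfl⟩ := h
    rcases H.accelerate_emit C hA with ⟨h1, h2⟩ | ⟨h1, h2, h3⟩ | ⟨h1, b, h2, h3⟩
    · simp [h1, h2, hd]
    · have : d.pos = 0 := by
        cases hp : d.pos with
        | zero => rfl
        | succ i =>
          rw [hp] at h2
          cases hz : z[i]? <;> simp [inputSym, hz] at h2
      simp [h1, h3, hd, this]
    · cases hp : d.pos with
      | zero => rw [hp] at h2; simp [inputSym] at h2
      | succ i =>
        rw [hp] at h2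
        cases hz : z[i]? with
        | none => simp [inputSym, hz] at h2
        | some b' =>
          simp only [inputSym, hz, Option.elim_some, InSym.letter.injEq] at h2
          subst h2
          simp [h1, h3, hd, hp, List.take_add_one, hz]

variable {H C}

/-- The configuration `c` of `H` is split into the buffers and the tapes of the accelerated machine
in the configuration `e`. -/
def Represents (c : H.Cfg) (e : (H.accelerate C).Cfg) : Prop :=
  ∃ (d : H.Cfg) (bs : H.ι → List (H.Buffer C)),
    e.state = (.simulate, false, H.clip C d) ∧
    (∀ i, e.work (H.tapeEquiv i) = stackTape (bs i)) ∧
    c = d.onTop (fun i => ((bs i).map Subtype.val).flatten) ∧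
    (∀ i, ∀ l ∈ bs i, l.1.length = C) ∧
    (∀ i, (d.stack i).length ≤ 2 * C) ∧
    ∀ i, C ≤ (d.stack i).length ∨ bs i = []

/-- The exchange of a block between a buffer and a stack of blocks, in the phases `fetch` and
`store`. -/
theorem exchange (hC : 0 < C) (l : H.Buffer C) (bs : List (H.Buffer C))
    (hbs : ∀ u ∈ bs, u.1.length = C) :
    let l₁ := fetchBuffer l bs.head?
    let T₁ := (fetchMove l).elim ((stackTape bs).write (fetchWrite l bs.head?))
      fun d => ((stackTape bs).write (fetchWrite l bs.head?)).move d
    ∃ bs' : List (H.Buffer C), T₁.write (storeWrite l₁ T₁.head) = stackTape bs' ∧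
      l.1 ++ (bs.map Subtype.val).flatten =
        (storeBuffer l₁).1 ++ (bs'.map Subtype.val).flatten ∧
      (∀ u ∈ bs', u.1.length = C) ∧ (storeBuffer l₁).1.length ≤ 2 * C ∧
      (C ≤ (storeBuffer l₁).1.length ∨ bs' = []) := by
  have hself : (stackTape bs).write bs.head? = stackTape bs := Turing.Tape.write_self (stackTape bs)
  obtain ⟨l, hl⟩ := l
  simp only [fetchBuffer, fetchMove, fetchWrite, storeBuffer, storeWrite]
  rcases lt_or_ge l.length C with h | h
  · have hlen : (l ++ bs.head?.elim [] Subtype.val).length < 2 * C ∧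
        (C ≤ (l ++ bs.head?.elim [] Subtype.val).length ∨ bs.tail = []) := by
      cases bs with
      | nil => simp; omega
      | cons u bs => have := hbs u (by simp); simp; omega
    have hv := clipList_val (H := H) (l := l ++ bs.head?.elim [] Subtype.val) (C := C) (by omega)
    simp only [h, if_true, Option.elim_some, stackTape_pop, hv, not_le.2 hlen.1, if_false,
      Turing.Tape.write_self]
    refine ⟨bs.tail, rfl, ?_, fun u hu => hbs u (List.mem_of_mem_tail hu), hlen.1.le, hlen.2⟩
    cases bs <;> simp
  · simp only [not_lt.2 h, if_false, hself]
    rcases lt_or_ge l.length (2 * C) with h2 | h2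
    · simp only [not_le.2 h2, if_false, Option.elim_none, Turing.Tape.write_self]
      exact ⟨bs, rfl, rfl, hbs, h2.le, Or.inl h⟩
    · have hv1 := clipList_val (H := H) (l := l.take (l.length - C)) (C := C) (by simp; omega)
      have hv2 := clipList_val (H := H) (l := l.drop (l.length - C)) (C := C) (by simp; omega)
      simp only [h2, if_true, Option.elim_some, hv1, stackTape_push]
      refine ⟨_, rfl, ?_, ?_, ?_, ?_⟩
      · simp [hv2, ← List.append_assoc]
      · intro u hu
        rcases List.mem_cons.1 hu with rfl | hu
        · rw [hv2]; simp; omega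
        · exact hbs u hu
      · simp; omega
      · left; simp; omega

/-- Three transitions of the accelerated machine simulate `C` steps of `H`, or fewer if the current
letter is finished earlier. -/
theorem Represents.three_steps (hC : 0 < C) {c : H.Cfg} {e : (H.accelerate C).Cfg}
    (h : Represents c e) {z : List Bool} {b : Bool} (hz : inputSym z e.pos = .letter b) :
    ∃ e', (H.accelerate C).iter z 3 e = some e' ∧ Represents (H.steps b C c).1 e' ∧
      e'.pos = (if (H.steps b C c).2 then e.pos + 1 else e.pos) := by
  obtain ⟨d, bs, hs, hw, rfl, hbl, hd, hd'⟩ := h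
  obtain ⟨q, p, w, o⟩ := e
  simp only at hs hw hz
  subst hs
  have hsteps := steps_onTop b C d (fun i => ((bs i).map Subtype.val).flatten)
    (fun i => (hd' i).imp_right fun h => by simp [h])
  have hlen : ∀ i, ((H.steps b C d).1.stack i).length ≤ 3 * C := fun i => by
    have := length_steps_le b C d i
    have := hd i
    omega
  have hclip := toCfg_clip (H := H) (C := C) (c := d) fun i => (hd i).trans (by omega)
  have hv : ∀ i, (H.clipList C ((H.steps b C d).1.stack i)).1 = (H.steps b C d).1.stack i :=
    fun i => clipList_val (hlen i)
  have hex := fun i => exchange hC (H.clipList C ((H.steps b C d).1.stack i)) (bs i) (hbl i)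
  choose bs' h1 h2 h3 h4 h5 using hex
  set r := H.clip C (H.steps b C d).1 with hr
  set f := (H.steps b C d).2
  let r₁ : H.BoundedCfg C := (r.1, fun i => fetchBuffer (r.2 i) ((w (H.tapeEquiv i)).head))
  let w₁ : Fin (H.accelerate C).tapes → Turing.Tape (H.accelerate C).Γ := fun j =>
    (fetchMove (r.2 (H.tapeEquiv.symm j))).elim
      ((w j).write (fetchWrite (r.2 (H.tapeEquiv.symm j)) (w j).head))
      fun d => ((w j).write (fetchWrite (r.2 (H.tapeEquiv.symm j)) (w j).head)).move d
  let r₂ : H.BoundedCfg C := (r₁.1, fun i => storeBuffer (r₁.2 i))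
  let w₂ : Fin (H.accelerate C).tapes → Turing.Tape (H.accelerate C).Γ := fun j =>
    (w₁ j).write (storeWrite (r₁.2 (H.tapeEquiv.symm j)) (w₁ j).head)
  have step₁ : (H.accelerate C).step z ⟨(.simulate, false, H.clip C d), p, w, o⟩ =
      some ⟨(.fetch, f, r), p, w, o⟩ := by
    have : (H.accelerate C).step z ⟨(.simulate, false, H.clip C d), p, w, o⟩ =
        some ⟨(.fetch, (H.steps b C (H.clip C d).toCfg).2,
          H.clip C (H.steps b C (H.clip C d).toCfg).1), p,
          fun i => (w i).write (w i).head, o ++ []⟩ := by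
      simp only [IOMachine.step, hz]; rfl
    rw [this, hclip]
    simp only [Turing.Tape.write_self, List.append_nil, f, r]
  have step₂ : (H.accelerate C).step z ⟨(.fetch, f, r), p, w, o⟩ =
      some ⟨(.store, f, r₁), p, w₁, o ++ []⟩ := by
    simp only [IOMachine.step, hz]; rfl
  have step₃ : (H.accelerate C).step z ⟨(.store, f, r₁), p, w₁, o ++ []⟩ =
      some ⟨(.simulate, false, r₂), if f then p + 1 else p, w₂,
        o ++ [] ++ (if f then some b else none).toList⟩ := by
    simp only [IOMachine.step, hz]; rfl
  have hr₂ : ∀ i, r₂.2 i = storeBuffer (fetchBuffer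
      (H.clipList C ((H.steps b C d).1.stack i)) (bs i).head?) := fun i => by
    simp only [r₂, r₁, hw]; rfl
  have hw₂ : ∀ i, w₂ (H.tapeEquiv i) = stackTape (bs' i) := fun i => by
    rw [← h1 i]
    simp only [w₂, w₁, r₁, hw, Equiv.symm_apply_apply]; rfl
  rw [hsteps]
  refine ⟨⟨(.simulate, false, r₂), if f then p + 1 else p, w₂,
      o ++ [] ++ (if f then some b else none).toList⟩,
    by simp only [IOMachine.iter, step₁, step₂, step₃, Option.bind_some],
    ⟨⟨(H.steps b C d).1.state, fun i => (r₂.2 i).1⟩, bs', ?_, hw₂, ?_, h3, ?_, ?_⟩, rfl⟩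
  · have : r₂ = H.clip C ⟨(H.steps b C d).1.state, fun i => (r₂.2 i).1⟩ :=
      Prod.ext rfl (funext fun i => Subtype.ext (clipList_val (r₂.2 i).2).symm)
    rw [← this]
  · simp only [Cfg.onTop, Cfg.mk.injEq, true_and]
    funext i
    rw [hr₂, ← h2, hv]
  · intro i
    simp only [hr₂]
    exact h4 i
  · intro i
    simp only [hr₂]
    exact h5 i

/-- Processing a letter in `t` steps of `H` takes at most `3 * (t / C + 1)` transitions of the
accelerated machine. -/
theorem Represents.processes (hC : 0 < C) {c c' : H.Cfg} {e : (H.accelerate C).Cfg}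
    (h : Represents c e) {z : List Bool} {b : Bool} (hz : inputSym z e.pos = .letter b) {t : ℕ}
    (ht : H.Processes b c t c') :
    ∃ s e', (H.accelerate C).iter z s e = some e' ∧ Represents c' e' ∧ e'.pos = e.pos + 1 ∧
      C * s ≤ 3 * (t + C) := by
  induction t using Nat.strong_induction_on generalizing c e with
  | _ t ih =>
    obtain ⟨e₁, h1, h2, h3⟩ := h.three_steps hC hz
    rcases le_or_gt t C with htC | htC
    · rw [ht.steps_of_le htC] at h2 h3
      exact ⟨3, e₁, h1, h2, h3, by nlinarith⟩
    · obtain ⟨c₁, h4, h5⟩ := ht.steps_of_lt htC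
      rw [h4] at h2 h3
      obtain ⟨s, e', h6, h7, h8, h9⟩ := ih (t - C) (by omega) h2 (by rw [h3]; exact hz) h5
      refine ⟨3 + s, e', by rw [IOMachine.iter_add _ h1, h6], h7, by rw [h8, h3]; rfl, ?_⟩
      obtain ⟨u, rfl⟩ : ∃ u, t = C + u := ⟨t - C, by omega⟩
      rw [Nat.add_sub_cancel_left] at h9
      linarith

/-- Processing a word of length `n` in `t` steps of `H` takes at most `3 * (t / C + n)`
transitions of the accelerated machine. -/
theorem Represents.reads (hC : 0 < C) {c c' : H.Cfg} {e : (H.accelerate C).Cfg}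
    (h : Represents c e) {x y : List Bool} (hp : e.pos = x.length + 1) {t : ℕ}
    (ht : H.Reads c y t c') :
    ∃ s e', (H.accelerate C).iter (x ++ y) s e = some e' ∧ Represents c' e' ∧
      e'.pos = (x ++ y).length + 1 ∧ C * s ≤ 3 * (t + C * y.length) := by
  induction ht generalizing x e with
  | nil => exact ⟨0, e, rfl, h, by simpa using hp, by simp⟩
  | @cons c b t c₁ y u c' h1 _ ih =>
    obtain ⟨s, e₁, h2, h3, h4, h5⟩ :=
      h.processes hC (z := x ++ b :: y) (by rw [hp]; exact inputSym_append_cons x b y) h1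
    obtain ⟨s', e', h6, h7, h8, h9⟩ := ih h3 (x := x ++ [b]) (by simp [h4, hp])
    rw [List.append_assoc, List.singleton_append] at h6 h8
    refine ⟨s + s', e', by rw [IOMachine.iter_add _ h2, h6], h7, h8, ?_⟩
    rw [List.length_cons]
    linarith

variable (H C)

/-- The accelerated machine after its first transition. -/
theorem exists_represents_init (z : List Bool) :
    ∃ e, (H.accelerate C).iter z 1 (H.accelerate C).init = some e ∧ Represents H.init e ∧
      e.pos = 1 := by
  refine ⟨⟨(.simulate, false, H.clip C H.init), 1, fun _ => stackTape [], []⟩, rfl,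
    ⟨H.init, fun _ => [], rfl, fun _ => rfl, ?_, by simp, by simp [init], by simp⟩, rfl⟩
  simp [init, Cfg.onTop]

/-- The partial identity on the set of accepted words. -/
def partialId : WordFun := fun x => ⟨H.Accepts x, fun _ => x⟩

theorem partialId_maps (x y : List Bool) : H.partialId.Maps x y ↔ H.Accepts x ∧ y = x := by
  change y ∈ Part.mk _ _ ↔ _
  simp [Part.mem_mk_iff, eq_comm]

variable {H C}

/-- On an input that `H` processes in `t` steps, the accelerated machine halts, and it outputs this
input if and only if `H` accepts it. -/
theorem accelerate_run (hC : 0 < C) {x : List Bool} {t : ℕ} {c : H.Cfg}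
    (h : H.Reads H.init x t c) :
    (∃ T, C * T ≤ 3 * t + C * (3 * x.length + 2) ∧ (H.accelerate C).HaltsWithin x T) ∧
      ∀ y, (H.accelerate C).Outputs x y ↔ H.Accepts x ∧ y = x := by
  obtain ⟨e₀, h0, h1, h2⟩ := H.exists_represents_init C x
  obtain ⟨s, e, h3, h4, h5, h6⟩ := h1.reads hC (x := []) h2 h
  rw [List.nil_append] at h3 h5
  have hrun : (H.accelerate C).run x (1 + s) = some e := by
    have := (H.accelerate C).run_add_iter (z := x) (t := 0) rfl (1 + s)
    rw [zero_add] at this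
    rw [this, IOMachine.iter_add _ h0, h3]
  have hout := H.accelerate_output C hrun
  rw [h5, Nat.add_sub_cancel, List.take_length] at hout
  obtain ⟨d, bs, hs, hw, hcd, -⟩ := h4
  have hstate : d.state = c.state := by rw [hcd]; rfl
  have hblank := inputSym_of_length_lt (z := x) (p := e.pos) (by omega)
  obtain ⟨q, p, w, o⟩ := e
  simp only at hs hblank hout
  subst hs hout
  rw [accepts_iff h, ← hstate]
  by_cases hacc : d.state = H.acc
  · have hstep : (H.accelerate C).step o ⟨(.simulate, false, H.clip C d), p, w, o⟩ =
        some ⟨(H.accelerate C).out, p, fun i => (w i).write (w i).head, o ++ []⟩ := by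
      simp only [IOMachine.step, hblank, accelerate, clip, hacc, if_true]; rfl
    have hrun' : (H.accelerate C).run o (1 + s + 1) =
        some ⟨(H.accelerate C).out, p, fun i => (w i).write (w i).head, o ++ []⟩ := by
      rw [IOMachine.run, hrun]; exact hstep
    have hhalt := (H.accelerate C).step_out (z := o)
      (c := ⟨(H.accelerate C).out, p, fun i => (w i).write (w i).head, o ++ []⟩) rfl
    refine ⟨⟨1 + s + 1, by nlinarith, 1 + s + 1, le_rfl, _, hrun', hhalt⟩, fun y => ?_⟩
    rw [IOMachine.outputs_iff_of_halt _ hrun' hhalt]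
    simp [hacc, eq_comm]
  · have hhalt : (H.accelerate C).step o ⟨(.simulate, false, H.clip C d), p, w, o⟩ = none := by
      simp only [IOMachine.step, hblank, accelerate, clip, hacc, if_false]; rfl
    refine ⟨⟨1 + s, by nlinarith, 1 + s, le_rfl, _, hrun, hhalt⟩, fun y => ?_⟩
    rw [IOMachine.outputs_iff_of_halt _ hrun hhalt]
    simp [hacc, accelerate]

/-- If processing any word of length `n` takes `O(n ^ k)` steps, no matter with which constant, then
the partial identity on the accepted words is in `S_2^(q)` for `q(n) = a n^k + a`: the constant is
absorbed by the length `C` of the blocks. -/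
theorem partialId_mem_S2 {K a k : ℕ} (hk : 1 ≤ k) (ha : 5 ≤ a)
    (hT : ∀ x : List Bool, ∃ t c, H.Reads H.init x t c ∧ t ≤ K * (x.length ^ k + 1)) :
    H.partialId ∈ S2 (fun n => a * n ^ k + a) := by
  -- Blocks of this length reduce the `K * (n ^ k + 1)` steps to at most `n ^ k + 1` transitions; at
  -- most `3 * n + 2` transitions are added.
  have hC : 0 < 3 * K + 1 := by omega
  set M := H.accelerate (3 * K + 1) with hM
  have hout : ∀ x y, M.Outputs x y ↔ H.Accepts x ∧ y = x := fun x => by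
    obtain ⟨t, c, h, -⟩ := hT x
    exact (accelerate_run hC h).2
  have htime : ∀ x, M.HaltsWithin x (builtinPoly a k x.length) := fun x => by
    obtain ⟨t, c, h, ht⟩ := hT x
    obtain ⟨⟨T, hT, s, hs, hh⟩, -⟩ := accelerate_run hC h
    refine ⟨s, hs.trans ?_, hh⟩
    have hn : x.length ≤ x.length ^ k := Nat.le_self_pow (by omega) _
    have h1 : (3 * K + 1) * T ≤ (3 * K + 1) * (x.length ^ k + 1 + (3 * x.length + 2)) := by
      nlinarith
    have h2 := Nat.le_of_mul_le_mul_left h1 hC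
    unfold builtinPoly
    nlinarith
  have hbal : ∀ x : List Bool, x.length ≤ builtinPoly a k x.length := fun x => by
    have hn : x.length ≤ x.length ^ k := Nat.le_self_pow (by omega) _
    unfold builtinPoly
    nlinarith
  have hcomp : M.Computes H.partialId := fun x y => by rw [hout, partialId_maps]
  have hpoly : ∀ n, (Polynomial.C a * Polynomial.X ^ k + Polynomial.C a : Polynomial ℕ).eval n =
      builtinPoly a k n := fun n => by simp [builtinPoly]
  refine ⟨⟨⟨⟨Polynomial.X, Polynomial.X, ?_⟩, M,
    Polynomial.C a * Polynomial.X ^ k + Polynomial.C a, hcomp, fun x => ?_⟩, ?_⟩,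
    ⟨M, a, k, by omega, hk, ?_, ?_, htime, ?_⟩, fun n => le_rfl, hcomp⟩
  · intro x y h
    obtain ⟨-, rfl⟩ := (H.partialId_maps x y).1 h
    simp
  · rw [hpoly]; exact htime x
  · intro x y h w
    obtain ⟨h, rfl⟩ := (H.partialId_maps x y).1 h
    exact (H.partialId_maps _ _).2 ⟨h.append w, rfl⟩
  · intro x y h z t c hrun hpos _
    obtain ⟨-, rfl⟩ := (hout x y).1 h
    rw [H.accelerate_output _ hrun, List.take_append,
      List.take_of_length_le (by omega)]
    exact List.prefix_append _ _
  · intro x y h z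
    obtain ⟨h, rfl⟩ := (hout x y).1 h
    refine ⟨(hout _ _).2 ⟨h.append z, rfl⟩, fun t c c' _ hpos hstep => ?_⟩
    simp only [IOMachine.step, inputSym_of_length_lt hpos, Option.map_eq_some_iff] at hstep
    obtain ⟨A, hA, rfl⟩ := hstep
    exact H.accelerate_blank _ hA
  · intro x y h
    obtain ⟨-, rfl⟩ := (hout x y).1 h
    exact hbal y

end OnlineStackMachine

/-! ### The diagonal machine -/

section Diagonal

variable {m : ℕ} (M : Fin (m + 1) → IOMachine)

/-- Stack letters of the diagonal machine: bits, and the work tape letters of the machines. -/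
abbrev DiagSym : Type := Bool ⊕ (Σ i, (M i).Γ)

/-- Stacks of the diagonal machine: the remaining input and the reversed output of the simulated
machine, the clock, and for each work tape its parts to the left and to the right of the head. -/
inductive DiagStack : Type
  | input
  | output
  | clock
  | left (i : Fin (m + 1)) (j : Fin (M i).tapes)
  | right (i : Fin (m + 1)) (j : Fin (M i).tapes)

/-- States of the diagonal machine: waiting, with a selected machine; moving the stack `output` to
the stack `input`; simulating a machine, where it is kept whether its input head is on the left
endmarker, and its state and the letters under its work tape heads; clearing the stacks; and
accepting. -/
inductive DiagState : Type
  | wait (i : Fin (m + 1))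
  | transfer (i : Fin (m + 1))
  | simulate (i : Fin (m + 1)) (mark : Bool) (q : (M i).Q) (h : Fin (M i).tapes → (M i).Γ)
  | clear
  | acc

instance : Finite (DiagStack M) :=
  Finite.of_surjective
    (α := (Fin 3 ⊕ (Σ i, Fin (M i).tapes)) ⊕ (Σ i, Fin (M i).tapes))
    (fun s => match s with
      | .inl (.inl 0) => .input
      | .inl (.inl 1) => .output
      | .inl (.inl 2) => .clock
      | .inl (.inr ⟨i, j⟩) => .left i j
      | .inr ⟨i, j⟩ => .right i j)
    (by
      intro s
      cases s with
      | input => exact ⟨.inl (.inl 0), rfl⟩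
      | output => exact ⟨.inl (.inl 1), rfl⟩
      | clock => exact ⟨.inl (.inl 2), rfl⟩
      | left i j => exact ⟨.inl (.inr ⟨i, j⟩), rfl⟩
      | right i j => exact ⟨.inr ⟨i, j⟩, rfl⟩)

instance : Finite (DiagState M) :=
  Finite.of_surjective
    (α := (Fin (m + 1) ⊕ Fin (m + 1)) ⊕
      ((Σ i, Bool × (M i).Q × (Fin (M i).tapes → (M i).Γ)) ⊕ Bool))
    (fun s => match s with
      | .inl (.inl i) => .wait i
      | .inl (.inr i) => .transfer i
      | .inr (.inl ⟨i, b, q, h⟩) => .simulate i b q h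
      | .inr (.inr false) => .clear
      | .inr (.inr true) => .acc)
    (by
      intro s
      cases s with
      | wait i => exact ⟨.inl (.inl i), rfl⟩
      | transfer i => exact ⟨.inl (.inr i), rfl⟩
      | simulate i b q h => exact ⟨.inr (.inl ⟨i, b, q, h⟩), rfl⟩
      | clear => exact ⟨.inr (.inr false), rfl⟩
      | acc => exact ⟨.inr (.inr true), rfl⟩)

variable {M}

/-- The letter of the `i`-th machine on the top of a stack; the empty stack stands for blanks. -/
def decodeTape (i : Fin (m + 1)) : Option (DiagSym M) → (M i).Γ
  | some (.inr ⟨i', g⟩) => if e : i' = i then e ▸ g else default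
  | _ => default

/-- The input letter seen by the simulated machine; `mark` tells whether its input head is on the
left endmarker. -/
def decodeInput (mark : Bool) : Option (DiagSym M) → InSym
  | some (.inl b) => if mark then .lmark else .letter b
  | _ => if mark then .lmark else .blank

/-- The stack instructions that simulate the action `A` of the `i`-th machine. -/
def simulateOps (i : Fin (m + 1)) (mark : Bool)
    (A : MachineAction (M i).Q (M i).Γ (M i).tapes) : DiagStack M → StackOp (DiagSym M)
  | .input => if A.advance && !mark then .pop else .keep
  | .output => A.emit.elim .keep fun b => .push (.inl b)
  | .clock => .push (.inl true)
  | .left i' j =>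
    if e : i' = i then
      match A.move (e ▸ j) with
      | none => .keep
      | some .left => .pop
      | some .right => .push (.inr ⟨i, A.write (e ▸ j)⟩)
    else .keep
  | .right i' j =>
    if e : i' = i then
      match A.move (e ▸ j) with
      | none => .keep
      | some .left => .push (.inr ⟨i, A.write (e ▸ j)⟩)
      | some .right => .pop
    else .keep

/-- The letters under the work tape heads after the action `A` of the `i`-th machine. -/
def simulateHeads (i : Fin (m + 1)) (A : MachineAction (M i).Q (M i).Γ (M i).tapes)
    (g : DiagStack M → Option (DiagSym M)) (j : Fin (M i).tapes) : (M i).Γ :=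
  match A.move j with
  | none => A.write j
  | some .left => decodeTape i (g (.left i j))
  | some .right => decodeTape i (g (.right i j))

/-- The stacks which have to be empty when a simulation begins are empty, as far as can be seen
from the tops of the stacks. -/
def IsCleared (g : DiagStack M → Option (DiagSym M)) : Prop :=
  g .input = none ∧ (∀ i j, g (.left i j) = none) ∧ ∀ i j, g (.right i j) = none

variable (M)

open Classical in
/-- The transitions of the diagonal machine. -/
noncomputable def diagTransition : DiagState M → Bool → (DiagStack M → Option (DiagSym M)) →
    (DiagState M × Bool) × (DiagStack M → StackOp (DiagSym M))
  | .wait i, true, _ => ((.wait (i + 1), true), fun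
      | .output => .push (.inl true)
      | _ => .keep)
  | .wait i, false, g =>
      if g .clock = none then
        ((.transfer i, false), fun
          | .output => .push (.inl false)
          | _ => .keep)
      else
        ((.wait i, true), fun
          | .output => .push (.inl false)
          | .clock => .pop
          | _ => .keep)
  | .transfer i, _, g =>
      (g .output).elim
        ((.simulate i true (M i).start fun _ => default, false), fun
          | .clock => .push (.inl true)
          | _ => .keep)
        fun x => ((.transfer i, false), fun
          | .output => .pop
          | .input => .push x
          | .clock => .push (.inl true)
          | _ => .keep)
  | .simulate i mark q h, _, g =>
      ((M i).δ q (decodeInput mark (g .input)) h).elim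
        (if q = (M i).out then
          ((.clear, false), fun
            | .clock => .push (.inl true)
            | _ => .keep)
        else ((.acc, true), fun _ => .keep))
        fun A => ((.simulate i (mark && !A.advance) A.state (simulateHeads i A g), false),
          simulateOps i mark A)
  | .clear, _, g =>
      if IsCleared g then ((.wait 0, true), fun _ => .keep)
      else ((.clear, false), fun
        | .output => .keep
        | .clock => .push (.inl true)
        | _ => .pop)
  | .acc, _, _ => ((.acc, true), fun _ => .keep)

/-- The machine that differs from every product of the functions of the machines `M i`.

While waiting, it appends the letters read to the stack `output`, which then holds the current
value of a product `g_j ⋯ g_1`. The letter `1` selects the next machine, cyclically; the letter `0`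
pops a symbol from the clock. When a letter `0` is read while the clock is empty, the selected
machine is applied to the current value. If it has no output on it then the diagonal machine
accepts; otherwise the output is the new current value. The clock counts the steps made for this,
so that as many letters `0` have to be read before the next application. -/
noncomputable def diagMachine : OnlineStackMachine where
  Q := DiagState M
  Γ := DiagSym M
  ι := DiagStack M
  start := .wait 0
  acc := .acc
  δ := diagTransition M
  δ_acc _ _ := rfl

/-- The stack contents between the simulations. -/
def diagStacks (u w : List Bool) (n : ℕ) : DiagStack M → List (DiagSym M)
  | .input => u.map .inl
  | .output => w.map .inl
  | .clock => List.replicate n (.inl true)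
  | _ => []

/-- The waiting configuration with selected machine `i`, current value `y` and clock `n`. -/
def diagWait (i : Fin (m + 1)) (y : List Bool) (n : ℕ) : (diagMachine M).Cfg :=
  ⟨.wait i, diagStacks M [] y.reverse n⟩

open OnlineStackMachine

theorem diag_step {q : DiagState M} {b : Bool} {s : DiagStack M → List (DiagSym M)}
    {q' : DiagState M} {f : Bool} {o : DiagStack M → StackOp (DiagSym M)}
    (h : diagTransition M q b (fun r => (s r).head?) = ((q', f), o)) :
    (diagMachine M).step b ⟨q, s⟩ = (⟨q', fun r => (o r).apply (s r)⟩, f) :=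
  congrArg (fun r : (DiagState M × Bool) × (DiagStack M → StackOp (DiagSym M)) =>
    ((⟨r.1.1, fun i => (r.2 i).apply (s i)⟩ : (diagMachine M).Cfg), r.1.2)) h

theorem diag_init : (diagMachine M).init = diagWait M 0 [] 0 := by
  refine Cfg.ext rfl (funext fun s => ?_)
  cases s <;> rfl

theorem diag_wait_true (i : Fin (m + 1)) (y : List Bool) (n : ℕ) :
    (diagMachine M).Processes true (diagWait M i y n) 1 (diagWait M (i + 1) (y ++ [true]) n) := by
  refine .finish (Prod.ext (Cfg.ext rfl ?_) rfl)
  funext s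
  cases s <;> simp [step, diagMachine, diagTransition, diagWait, diagStacks, StackOp.apply]

theorem diag_wait_false (i : Fin (m + 1)) (y : List Bool) (n : ℕ) :
    (diagMachine M).Processes false (diagWait M i y (n + 1)) 1
      (diagWait M i (y ++ [false]) n) := by
  refine .finish ?_
  simp only [step, diagMachine, diagTransition, diagWait, diagStacks, List.replicate_succ,
    List.head?_cons, reduceCtorEq, if_false, Prod.mk.injEq, and_true, Cfg.mk.injEq, true_and]
  funext s
  cases s <;> simp [StackOp.apply, diagStacks]

theorem diag_wait_zero (i : Fin (m + 1)) (y : List Bool) :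
    (diagMachine M).Steps false (diagWait M i y 0) 1
      ⟨.transfer i, diagStacks M [] (y ++ [false]).reverse 0⟩ := by
  refine .head ?_ (.refl _)
  simp only [step, diagMachine, diagTransition, diagWait, diagStacks, List.replicate_zero,
    List.head?_nil, if_true, Prod.mk.injEq, and_true, Cfg.mk.injEq, true_and]
  funext s
  cases s <;> simp [StackOp.apply, diagStacks]

theorem diag_transfer (b : Bool) (i : Fin (m + 1)) (u w : List Bool) (n : ℕ) :
    (diagMachine M).Steps b ⟨.transfer i, diagStacks M u w n⟩ (w.length + 1)
      ⟨.simulate i true (M i).start fun _ => default,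
        diagStacks M (w.reverse ++ u) [] (n + w.length + 1)⟩ := by
  induction w generalizing u n with
  | nil =>
    refine .head ?_ (.refl _)
    simp only [step, diagMachine, diagTransition, diagStacks, List.map_nil,
      List.head?_nil, Option.elim_none, Prod.mk.injEq, and_true, Cfg.mk.injEq, true_and]
    funext s
    cases s <;> simp [StackOp.apply, diagStacks, List.replicate_succ]
  | cons x w ih =>
    have := ih (x :: u) (n + 1)
    rw [show (x :: w).reverse ++ u = w.reverse ++ x :: u by simp,
      show n + (x :: w).length + 1 = n + 1 + w.length + 1 by simp; omega]
    refine .head ?_ this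
    simp only [step, diagMachine, diagTransition, diagStacks, List.map_cons,
      List.head?_cons, Option.elim_some, Prod.mk.injEq, and_true, Cfg.mk.injEq, true_and]
    funext s
    cases s <;> simp [StackOp.apply, diagStacks, List.replicate_succ]

variable {M}

theorem decodeTape_head? (i : Fin (m + 1)) (l : List (M i).Γ) :
    decodeTape (M := M) i ((l.map fun g => (.inr ⟨i, g⟩ : DiagSym M)).head?) =
      (Turing.ListBlank.mk l).head := by
  cases l <;> simp [decodeTape]

theorem decodeInput_head? (v : List Bool) (p : ℕ) :
    decodeInput (M := M) (p == 0) (((v.drop (p - 1)).map .inl).head?) = inputSym v p := by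
  cases p with
  | zero => cases v <;> simp [decodeInput, inputSym]
  | succ p =>
    simp only [Nat.add_sub_cancel, List.head?_map, List.head?_drop, inputSym]
    cases v[p]? <;> simp [decodeInput]

/-- The state `q` and the stacks `s` of the diagonal machine represent the configuration `c` of the
`i`-th machine, after `t` transitions on the input `v`. The clock shows `n`. -/
structure Simulates (i : Fin (m + 1)) (v : List Bool) (t n : ℕ) (c : (M i).Cfg)
    (q : DiagState M) (s : DiagStack M → List (DiagSym M)) : Prop where
  state : q = .simulate i (c.pos == 0) c.state fun j => (c.work j).head
  input : s .input = (v.drop (c.pos - 1)).map .inl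
  output : s .output = c.output.reverse.map .inl
  output_le : c.output.length ≤ t
  clock : s .clock = List.replicate n (.inl true)
  left : ∀ j, ∃ l, s (.left i j) = l.map (fun g => .inr ⟨i, g⟩) ∧ l.length ≤ t ∧
    (c.work j).left = Turing.ListBlank.mk l
  right : ∀ j, ∃ l, s (.right i j) = l.map (fun g => .inr ⟨i, g⟩) ∧ l.length ≤ t ∧
    (c.work j).right = Turing.ListBlank.mk l
  left_ne : ∀ i' j, i' ≠ i → s (.left i' j) = []
  right_ne : ∀ i' j, i' ≠ i → s (.right i' j) = []

theorem simulates_init (i : Fin (m + 1)) (v : List Bool) (n : ℕ) :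
    Simulates i v 0 n (M i).init (.simulate i true (M i).start fun _ => default)
      (diagStacks M v [] n) where
  state := rfl
  input := rfl
  output := rfl
  output_le := le_rfl
  clock := rfl
  left _ := ⟨[], rfl, le_rfl, rfl⟩
  right _ := ⟨[], rfl, le_rfl, rfl⟩
  left_ne _ _ _ := rfl
  right_ne _ _ _ := rfl

theorem Simulates.step {i : Fin (m + 1)} {v : List Bool} {t n : ℕ} {c c' : (M i).Cfg}
    {q : DiagState M} {s : DiagStack M → List (DiagSym M)} (h : Simulates i v t n c q s)
    (hc : (M i).step v c = some c') (b : Bool) :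
    ∃ q' s', (diagMachine M).step b ⟨q, s⟩ = (⟨q', s'⟩, false) ∧
      Simulates i v (t + 1) (n + 1) c' q' s' := by
  obtain ⟨rfl, h1, h2, h3, h4, hl, hr, h5, h6⟩ := h
  simp only [IOMachine.step, Option.map_eq_some_iff] at hc
  obtain ⟨A, hA, rfl⟩ := hc
  refine ⟨_, _, diag_step M (q' := .simulate i ((c.pos == 0) && !A.advance) A.state
    (simulateHeads i A fun r => (s r).head?)) (o := simulateOps i (c.pos == 0) A) ?_, ?_⟩
  · simp only [diagTransition]
    rw [h1, decodeInput_head?, hA, Option.elim_some]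
  constructor
  · congr 1
    · cases A.advance <;> simp
    · funext j
      obtain ⟨l, hl1, -, hl3⟩ := hl j
      obtain ⟨r, hr1, -, hr3⟩ := hr j
      simp only [simulateHeads, hl1, hr1, decodeTape_head?]
      rcases A.move j with _ | _ | _ <;>
        simp [Turing.Tape.write, Turing.Tape.move, hl3, hr3]
  · simp only [simulateOps, h1]
    cases A.advance with
    | false => simp [StackOp.apply]
    | true => cases hp : c.pos <;> simp [StackOp.apply]
  · simp only [simulateOps, h2]
    cases A.emit <;> simp [StackOp.apply]
  · cases A.emit <;> simp <;> omega
  · simp only [simulateOps, h4, StackOp.apply, List.replicate_succ]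
  · intro j
    obtain ⟨l, hl1, hl2, hl3⟩ := hl j
    simp only [simulateOps, hl1, dif_pos]
    rcases A.move j with _ | _ | _
    · exact ⟨l, by simp [StackOp.apply], by omega, by simpa [Turing.Tape.write] using hl3⟩
    · exact ⟨l.tail, by simp [StackOp.apply], by simp; omega, by
        simp [Turing.Tape.write, Turing.Tape.move, hl3]⟩
    · exact ⟨A.write j :: l, by simp [StackOp.apply], by simp; omega, by
        simp [Turing.Tape.write, Turing.Tape.move, hl3]⟩
  · intro j
    obtain ⟨l, hl1, hl2, hl3⟩ := hr j
    simp only [simulateOps, hl1, dif_pos]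
    rcases A.move j with _ | _ | _
    · exact ⟨l, by simp [StackOp.apply], by omega, by simpa [Turing.Tape.write] using hl3⟩
    · exact ⟨A.write j :: l, by simp [StackOp.apply], by simp; omega, by
        simp [Turing.Tape.write, Turing.Tape.move, hl3]⟩
    · exact ⟨l.tail, by simp [StackOp.apply], by simp; omega, by
        simp [Turing.Tape.write, Turing.Tape.move, hl3]⟩
  · intro i' j hi
    simp [simulateOps, hi, StackOp.apply, h5 i' j hi]
  · intro i' j hi
    simp [simulateOps, hi, StackOp.apply, h6 i' j hi]

theorem Simulates.run {i : Fin (m + 1)} {v : List Bool} {n : ℕ}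
    {q : DiagState M} {s : DiagStack M → List (DiagSym M)}
    (h : Simulates i v 0 n (M i).init q s) (b : Bool) {t : ℕ}
    {c : (M i).Cfg} (hc : (M i).run v t = some c) :
    ∃ q' s', (diagMachine M).Steps b ⟨q, s⟩ t ⟨q', s'⟩ ∧ Simulates i v t (n + t) c q' s' := by
  induction t generalizing c with
  | zero =>
    simp only [IOMachine.run, Option.some.injEq] at hc
    subst hc
    exact ⟨q, s, .refl _, h⟩
  | succ t ih =>
    simp only [IOMachine.run, Option.bind_eq_some_iff] at hc
    obtain ⟨d, hd, hc⟩ := hc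
    obtain ⟨q₁, s₁, h1, h2⟩ := ih hd
    obtain ⟨q₂, s₂, h3, h4⟩ := h2.step hc b
    exact ⟨q₂, s₂, h1.trans (.head h3 (.refl _)), h4⟩

variable (M)

/-- Clearing takes at most as many steps as the highest of the stacks to be cleared has symbols. -/
theorem diag_clear (b : Bool) (s : DiagStack M → List (DiagSym M)) (w : List Bool) (n N : ℕ)
    (ho : s .output = w.map .inl) (hc : s .clock = List.replicate n (.inl true))
    (hi : (s .input).length ≤ N) (hl : ∀ i j, (s (.left i j)).length ≤ N)
    (hr : ∀ i j, (s (.right i j)).length ≤ N) :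
    ∃ t ≤ N, (diagMachine M).Steps b ⟨.clear, s⟩ t ⟨.clear, diagStacks M [] w (n + t)⟩ := by
  induction N generalizing s n with
  | zero =>
    simp only [Nat.le_zero, List.length_eq_zero_iff] at hi hl hr
    have : s = diagStacks M [] w n := by
      funext r
      cases r <;> simp [diagStacks, *]
    exact ⟨0, le_rfl, this ▸ .refl _⟩
  | succ N ih =>
    by_cases hs : IsCleared fun r => (s r).head?
    · obtain ⟨h1, h2, h3⟩ := hs
      simp only [List.head?_eq_none_iff] at h1 h2 h3
      obtain ⟨t, ht, h⟩ := ih s n ho hc (by simp [h1]) (by simp [h2]) (by simp [h3])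
      exact ⟨t, by omega, h⟩
    · let o : DiagStack M → StackOp (DiagSym M) := fun
        | .output => .keep
        | .clock => .push (.inl true)
        | _ => .pop
      have hstep := diag_step M (q := .clear) (b := b) (s := s) (q' := .clear) (f := false)
        (o := o) (if_neg hs)
      obtain ⟨t, ht, h⟩ := ih (fun r => (o r).apply (s r)) (n + 1) ho
        (by simp [o, StackOp.apply, hc, List.replicate_succ])
        (by simp [o, StackOp.apply]; omega)
        (fun i j => by have := hl i j; simp [o, StackOp.apply]; omega)
        (fun i j => by have := hr i j; simp [o, StackOp.apply]; omega)
      refine ⟨t + 1, by omega, .head hstep ?_⟩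
      rwa [show n + (t + 1) = n + 1 + t by omega]

/-- The application of the selected machine to the current value. -/
theorem diag_apply (i : Fin (m + 1)) (y : List Bool) {T : ℕ}
    (hT : (M i).HaltsWithin (y ++ [false]) T) :
    ∃ s c, (diagMachine M).Processes false (diagWait M i y 0) (s + 2) c ∧
      s ≤ 2 * (y.length + 1) + 2 * T + 2 ∧
      ((∃ y', (M i).Outputs (y ++ [false]) y' ∧ y'.length ≤ s ∧ c = diagWait M 0 y' s) ∨
        ((∀ y', ¬ (M i).Outputs (y ++ [false]) y') ∧ c.state = .acc)) := by
  obtain ⟨t, htT, c, hrun, hhalt⟩ := hT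
  set v := y ++ [false] with hv
  have h1 := diag_wait_zero M i y
  have h2 := diag_transfer M false i [] v.reverse 0
  rw [List.reverse_reverse, List.append_nil, List.length_reverse, zero_add] at h2
  obtain ⟨q, s, h3, h4⟩ := (simulates_init i v (v.length + 1)).run false hrun
  have h5 := (h1.trans h2).trans h3
  have hvl : v.length = y.length + 1 := by simp [hv]
  have hδ : (M i).δ c.state (inputSym v c.pos) (fun j => (c.work j).head) = none := by
    simpa [IOMachine.step] using hhalt
  obtain ⟨rfl, hi, ho, hol, hc, hl, hr, hln, hrn⟩ := h4
  have hout := IOMachine.outputs_iff_of_halt _ hrun hhalt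
  by_cases hq : c.state = (M i).out
  · let o : DiagStack M → StackOp (DiagSym M) := fun
      | .clock => .push (.inl true)
      | _ => .keep
    have h6 := diag_step M (q := .simulate i (c.pos == 0) c.state fun j => (c.work j).head)
      (b := false) (s := s) (q' := .clear) (f := false) (o := o)
      (by simp only [diagTransition]
          rw [hi, decodeInput_head?, hδ, Option.elim_none, if_pos hq])
    obtain ⟨d, hd, h7⟩ := diag_clear M false (fun r => (o r).apply (s r)) c.output.reverse
      (v.length + 1 + t + 1) (v.length + t) ho
      (by simp [o, StackOp.apply, hc, List.replicate_succ])
      (by simp [o, StackOp.apply, hi]; omega)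
      (fun i' j => by
        by_cases e : i' = i
        · subst e
          obtain ⟨l, h, h', -⟩ := hl j
          simp [o, StackOp.apply, h]; omega
        · simp [o, StackOp.apply, hln i' j e])
      (fun i' j => by
        by_cases e : i' = i
        · subst e
          obtain ⟨l, h, h', -⟩ := hr j
          simp [o, StackOp.apply, h]; omega
        · simp [o, StackOp.apply, hrn i' j e])
    have h8 := diag_step M (q := .clear) (b := false)
      (s := diagStacks M [] c.output.reverse (v.length + 1 + t + 1 + d)) (q' := .wait 0)
      (f := true) (o := fun _ => .keep) (if_pos ⟨rfl, fun _ _ => rfl, fun _ _ => rfl⟩)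
    have h9 := ((h5.trans (.head h6 h7)).processes (.finish h8))
    refine ⟨v.length + 1 + t + 1 + d, _, ?_, by omega, .inl ⟨c.output, (hout _).2 ⟨hq, rfl⟩,
      by omega, rfl⟩⟩
    rwa [show 1 + (v.length + 1) + t + (d + 1) + 1 = v.length + 1 + t + 1 + d + 2 by omega] at h9
  · have h6 := diag_step M (q := .simulate i (c.pos == 0) c.state fun j => (c.work j).head)
      (b := false) (s := s) (q' := .acc) (f := true) (o := fun _ => .keep)
      (by simp only [diagTransition]
          rw [hi, decodeInput_head?, hδ, Option.elim_none, if_neg hq])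
    have h7 := h5.processes (.finish h6)
    refine ⟨v.length + t + 1, ⟨.acc, s⟩, ?_, by omega, .inr ⟨fun y' h => hq ((hout y').1 h).1, rfl⟩⟩
    rwa [show 1 + (v.length + 1) + t + 1 = v.length + t + 1 + 2 by omega] at h7

/-- Reading a word of length `n` takes time `O(n ^ k)`: the clock prevents the times of the
applications of the machines from adding up to more. -/
theorem diag_reads {a k : ℕ} (hk : 1 ≤ k)
    (hT : ∀ i v, (M i).HaltsWithin v (a * v.length ^ k + a)) (x : List Bool) :
    let K := 4 * a * 2 ^ k + 2 * a + 12
    ∃ t c, (diagMachine M).Reads (diagMachine M).init x t c ∧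
      ((∃ i y n, c = diagWait M i y n ∧ t ≤ 2 * x.length + n ∧ y.length ≤ 2 * x.length + n ∧
          n ≤ K * (x.length ^ k + 1)) ∨
        (c.state = .acc ∧ t ≤ 2 * x.length + K * (x.length ^ k + 1))) := by
  intro K
  induction x using List.reverseRecOn with
  | nil =>
    exact ⟨0, _, .nil _, .inl ⟨0, [], 0, diag_init M, by simp, by simp, by simp⟩⟩
  | append_singleton x b ih =>
    obtain ⟨t, c, h, hcase⟩ := ih
    have hmono : K * (x.length ^ k + 1) ≤ K * ((x.length + 1) ^ k + 1) := by gcongr; omega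
    simp only [List.length_append, List.length_singleton]
    rcases hcase with ⟨i, y, n, rfl, ht, hy, hn⟩ | ⟨hacc, ht⟩
    · cases b with
      | true =>
        exact ⟨_, _, h.append (diag_wait_true M i y n).reads, .inl ⟨_, _, _, rfl, by omega,
          by simp; omega, by omega⟩⟩
      | false =>
        cases n with
        | succ n =>
          exact ⟨_, _, h.append (diag_wait_false M i y n).reads, .inl ⟨_, _, _, rfl, by omega,
            by simp; omega, by omega⟩⟩
        | zero =>
          obtain ⟨s, c, h1, h2, h3⟩ := diag_apply M i y (hT i _)
          have hlen : (y ++ [false]).length ≤ 2 * (x.length + 1) := by simp; omega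
          have hN : x.length + 1 ≤ (x.length + 1) ^ k := Nat.le_self_pow (by omega) _
          -- The clock is empty, so the current value has at most twice the length of the input;
          -- hence the factor `2 ^ k` in `K`.
          have hs : s + 2 ≤ K * ((x.length + 1) ^ k + 1) := by
            have h4 : (y ++ [false]).length ^ k ≤ 2 ^ k * (x.length + 1) ^ k := by
              rw [← mul_pow]; gcongr
            have h5 := Nat.mul_le_mul_left a h4
            simp only [K]
            nlinarith [Nat.zero_le (a * 2 ^ k), Nat.zero_le (a * (x.length + 1) ^ k),
              Nat.zero_le (a * (2 ^ k * (x.length + 1) ^ k))]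
          refine ⟨_, _, h.append h1.reads, ?_⟩
          rcases h3 with ⟨y', -, h6, rfl⟩ | ⟨-, h6⟩
          · exact .inl ⟨_, _, _, rfl, by omega, by omega, by omega⟩
          · exact .inr ⟨h6, by omega⟩
    · have := reads_of_acc (H := diagMachine M) hacc [b]
      exact ⟨_, _, h.append this, .inr ⟨hacc, by simp; omega⟩⟩

/-- Any machine can be selected, by sufficiently many letters `1`. -/
theorem diag_select (i : Fin (m + 1)) (y : List Bool) (n : ℕ) :
    ∃ z t, (diagMachine M).Reads (diagWait M 0 y n) z t (diagWait M i (y ++ z) n) := by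
  induction i using Fin.induction with
  | zero => exact ⟨[], 0, by simpa using .nil _⟩
  | succ i ih =>
    obtain ⟨z, t, h⟩ := ih
    refine ⟨z ++ [true], t + 1, ?_⟩
    rw [← List.append_assoc, ← Fin.coeSucc_eq_succ]
    exact h.append (diag_wait_true M _ _ n).reads

/-- Letters `0` run down the clock. -/
theorem diag_wait (i : Fin (m + 1)) (y : List Bool) (n : ℕ) :
    ∃ z t, (diagMachine M).Reads (diagWait M i y n) z t (diagWait M i (y ++ z) 0) := by
  induction n generalizing y with
  | zero => exact ⟨[], 0, by simpa using .nil _⟩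
  | succ n ih =>
    obtain ⟨z, t, h⟩ := ih (y ++ [false])
    rw [List.append_assoc] at h
    exact ⟨[false] ++ z, _, (diag_wait_false M i y n).reads.append h⟩

/-- Every product of the functions `g i` is defined on some word that the diagonal machine does not
accept, or undefined on some word that it accepts. For the induction, the product is applied to the
current value `y` of a waiting configuration, continued by the same letters. -/
theorem diag_ne_prod (g : Fin (m + 1) → WordFun) (hg : ∀ i, (M i).Computes (g i))
    (hri : ∀ i, (g i).IsRightIdealMorphism) (hT : ∀ i v, ∃ T, (M i).HaltsWithin v T)
    (w : List (Fin (m + 1))) {ξ y : List Bool} {n t : ℕ}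
    (h : (diagMachine M).Reads (diagMachine M).init ξ t (diagWait M 0 y n)) :
    ∃ z, (diagMachine M).Accepts (ξ ++ z) ↔ ¬ ∃ u, (w.map g).reverse.prod.Maps (y ++ z) u := by
  induction w generalizing ξ y n t with
  | nil =>
    refine ⟨[], ?_⟩
    rw [List.append_nil, accepts_iff h]
    simp [diagWait, diagMachine, WordFun.maps_one]
  | cons i w ih =>
    obtain ⟨z₁, t₁, h₁⟩ := diag_select M i y n
    obtain ⟨z₂, t₂, h₂⟩ := diag_wait M i (y ++ z₁) n
    obtain ⟨T, hT⟩ := hT i (y ++ z₁ ++ z₂ ++ [false])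
    obtain ⟨s, c, h₃, -, hcase⟩ := diag_apply M i (y ++ z₁ ++ z₂) hT
    have h₄ := ((h.append h₁).append h₂).append h₃.reads
    have hprod : ∀ x u, (((i :: w).map g).reverse.prod).Maps x u ↔
        ∃ v, (g i).Maps x v ∧ ((w.map g).reverse.prod).Maps v u := fun x u => by
      rw [List.map_cons, List.reverse_cons, List.prod_append, List.prod_singleton,
        WordFun.maps_mul]
    rcases hcase with ⟨y', hy', -, rfl⟩ | ⟨hno, hacc⟩
    · obtain ⟨z, hz⟩ := ih h₄
      refine ⟨z₁ ++ z₂ ++ [false] ++ z, ?_⟩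
      have hm := hri i _ _ ((hg i _ _).2 hy') z
      have huniq : ∀ v, (g i).Maps (y ++ z₁ ++ z₂ ++ [false] ++ z) v ↔ v = y' ++ z :=
        fun v => ⟨fun hv => Part.mem_unique hv hm, fun hv => hv ▸ hm⟩
      simp only [← List.append_assoc, hprod, huniq] at hz ⊢
      rw [hz]
      simp
    · refine ⟨z₁ ++ z₂ ++ [false], ?_⟩
      simp only [← List.append_assoc, hprod]
      rw [accepts_iff h₄]
      refine iff_of_true hacc ?_
      rintro ⟨u, v, hv, -⟩
      exact hno v ((hg i _ _).1 hv)

end Diagonal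

/-! ### Products of generators -/

theorem S2_nonempty {a k : ℕ} (hk : 1 ≤ k) (ha : 5 ≤ a) :
    (S2 (fun n => a * n ^ k + a)).Nonempty := by
  -- The machine that accepts every word yields the identity.
  let H : OnlineStackMachine :=
    { Q := Unit, Γ := Unit, ι := Unit, start := (), acc := ()
      δ := fun _ _ _ => (((), true), fun _ => .keep), δ_acc := fun _ _ => rfl }
  refine ⟨H.partialId, H.partialId_mem_S2 (K := 1) hk ha fun x =>
    ⟨_, _, OnlineStackMachine.reads_of_acc rfl x, ?_⟩⟩
  have hn : x.length ≤ x.length ^ k := Nat.le_self_pow (by omega) _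
  omega

/-- For any finite sequence of functions in `S_2^(q)`, `q(n) = a n^k + a`, there is a function in
`S_2^(q)` that is not a product of them. -/
theorem exists_mem_S2_ne_prod {a k m : ℕ} (hk : 1 ≤ k) (ha : 5 ≤ a) (g : Fin (m + 1) → WordFun)
    (hg : ∀ i, g i ∈ S2 (fun n => a * n ^ k + a)) :
    ∃ f ∈ S2 (fun n => a * n ^ k + a), ∀ w : List (Fin (m + 1)), (w.map g).prod ≠ f := by
  choose hRM P hP hcomp using hg
  let M : Fin (m + 1) → IOMachine := fun i => (P i).machine
  have hT : ∀ i v, (M i).HaltsWithin v (a * v.length ^ k + a) := fun i v => by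
    obtain ⟨t, ht, h⟩ := (P i).time_le v
    exact ⟨t, ht.trans (hP i _), h⟩
  refine ⟨(diagMachine M).partialId, OnlineStackMachine.partialId_mem_S2
    (K := 4 * a * 2 ^ k + 2 * a + 12 + 2) hk ha fun x => ?_, fun w hw => ?_⟩
  · obtain ⟨t, c, h, hcase⟩ := diag_reads M hk hT x
    have hn : x.length ≤ x.length ^ k := Nat.le_self_pow (by omega) _
    refine ⟨t, c, h, ?_⟩
    rw [add_mul _ 2]
    rcases hcase with ⟨-, -, n, -, h1, -, h2⟩ | ⟨-, h1⟩ <;> omega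
  · have hinit : (diagMachine M).Reads (diagMachine M).init [] 0 (diagWait M 0 [] 0) := by
      rw [← diag_init]; exact .nil _
    obtain ⟨z, hz⟩ := diag_ne_prod M g hcomp (fun i => (hRM i).2) (fun i v => ⟨_, hT i v⟩)
      w.reverse hinit
    simp only [List.map_reverse, List.reverse_reverse, hw, List.nil_append,
      OnlineStackMachine.partialId_maps] at hz
    exact iff_not_self (hz.trans (not_congr ⟨fun ⟨_, h, _⟩ => h, fun h => ⟨z, h, rfl⟩⟩))

theorem theorem3p6 :
    ∃ a₀ : ℕ, 1 < a₀ ∧ ∀ a k : ℕ, a₀ < a → 5 ≤ k →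
      ¬ (RM2 (fun n => a * n ^ k + a)).FG := by
  refine ⟨4, by norm_num, fun a k ha hk hfg => ?_⟩
  obtain ⟨T, hT⟩ := hfg
  set S := S2 (fun n => a * n ^ k + a) with hS
  have hlist : ∀ x ∈ T, ∃ l : List WordFun, (∀ y ∈ l, y ∈ S) ∧ l.prod = x := fun x hx =>
    Submonoid.exists_list_of_mem_closure (s := S)
      (show x ∈ RM2 _ from hT ▸ Submonoid.subset_closure hx)
  choose! l hl hprod using hlist
  -- The generators may be taken in `S`; one more element of `S` makes the sequence nonempty.
  obtain ⟨f₀, hf₀⟩ : S.Nonempty := S2_nonempty (by omega) (by omega)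
  let L : List WordFun := f₀ :: T.toList.flatMap l
  have hL : ∀ y ∈ L, y ∈ S := by
    intro y hy
    rcases List.mem_cons.1 hy with rfl | hy
    · exact hf₀
    · obtain ⟨x, hx, hy⟩ := List.mem_flatMap.1 hy
      exact hl x (Finset.mem_toList.1 hx) y hy
  obtain ⟨f, hf, hne⟩ := exists_mem_S2_ne_prod (m := (T.toList.flatMap l).length) (by omega)
    (by omega) (fun i => L.get i) (fun i => hL _ (List.get_mem L i))
  have hfT : f ∈ Submonoid.closure (T : Set WordFun) := hT ▸ Submonoid.subset_closure hf
  have hTL : Submonoid.closure (T : Set WordFun) ≤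
      Submonoid.closure (Set.range fun i => L.get i) := by
    refine Submonoid.closure_le.2 fun x hx => ?_
    rw [SetLike.mem_coe, ← hprod x hx]
    refine Submonoid.list_prod_mem _ fun y hy => Submonoid.subset_closure ?_
    have : y ∈ L := List.mem_cons_of_mem _ (List.mem_flatMap.2 ⟨x, Finset.mem_toList.2 hx, hy⟩)
    exact List.mem_iff_get.1 this
  obtain ⟨u, hu, hp⟩ := Submonoid.exists_list_of_mem_closure (hTL hfT)
  choose! w hw using hu
  refine hne (u.map w) ?_
  rw [List.map_map, ← hp]
  congr 1
  exact (List.map_congr_left fun y hy => hw y hy).trans (List.map_id _)
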